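/- Let $\pi=(d_1,\dots,d_n)$, $n\ge 1$, be a sequence of integers with sum $s=\sum_i d_i$, largest value $\Delta(\pi)$ and smallest value $\delta(\pi)$. Call $\pi$ \emph{graphic} if there is a simple graph on $n$ vertices whose vertex degrees are $d_1,\dots,d_n$. Let $$\operatorname{rg}(\pi)=\min\Bigl\{c\in\mathbb R,\ c\ge 0 \;:\; \tfrac sn-c\le d_i\le \tfrac sn+c\ \text{ for all } i\Bigr\}$$ be the largest distance of a value of $\pi$ from the mean value $s/n$. (A) Suppose that $0\le\delta(\pi)\le\Delta(\pi)\le n-1$ and that $s$ is even. Then $\pi$ is graphic in each of the following cases: 1. $\operatorname{rg}(\pi)\le\frac{n-2}{4}$ and $\frac{n-2}{4}\le\frac sn\le\frac{3n-2}{4}$; 2. $\operatorname{rg}(\pi)\le n-1-\frac sn$ and $\frac sn>\frac{3n-2}{4}$; 3. $\operatorname{rg}(\pi)\le\frac sn$ and $\frac sn<\frac{n-2}{4}$. (B) The bound in case 1 is tight in the following sense. Let $n\ge 2$ be even, let $m,c$ be integers with $c>\frac{n-2}{4}$, and let $\pi=\bigl((m+c)^{n/2},(m-c)^{n/2}\bigr)$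 be the sequence consisting of $n/2$ values $m+c$ followed by $n/2$ values $m-c$. Then $\pi$ is nonincreasing, its sum is even, its mean value is $s/n=m$, and $\operatorname{rg}(\pi)=c$; the Erdős–Gallai inequality $$\sum_{i=1}^{k}d_i\le k(k-1)+\sum_{i=k+1}^{n}\min(d_i,k)$$ fails for $\pi$ at $k=n/2$; and $\pi$ is not graphic. Moreover, for every even $n\ge 4$ there are integers $m,c$ with $\frac{n-2}{4}<c\le\frac{n-2}{4}+1$ and $\frac{n-2}{4}\le m\le\frac{3n-2}{4}$ for which all values of this sequence lie between $0$ and $n-1$. -/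

import Mathlib

namespace DegSeq

/-- `π` is graphic: some simple graph on `n` vertices has degrees `π 0, …, π (n-1)`. -/
def Graphic {n : ℕ} (π : Fin n → ℤ) : Prop :=
  ∃ (G : SimpleGraph (Fin n)) (_ : DecidableRel G.Adj), ∀ i, (G.degree i : ℤ) = π i

/-- The largest value `Δ(π)`. -/
def maxVal {n : ℕ} [NeZero n] (π : Fin n → ℤ) : ℤ :=
  Finset.univ.sup' Finset.univ_nonempty π

/-- The smallest value `δ(π)`. -/
def minVal {n : ℕ} [NeZero n] (π : Fin n → ℤ) : ℤ :=
  Finset.univ.inf' Finset.univ_nonempty π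

/-- The mean value `s / n`, where `s` is the sum of the sequence. -/
noncomputable def mean {n : ℕ} (π : Fin n → ℤ) : ℝ :=
  ((∑ i, π i : ℤ) : ℝ) / (n : ℝ)

/-- `π` is `c`-regular: every value lies within distance `c` of the mean value. -/
def IsRegular {n : ℕ} (π : Fin n → ℤ) (c : ℝ) : Prop :=
  ∀ i, mean π - c ≤ (π i : ℝ) ∧ (π i : ℝ) ≤ mean π + c

/-- `rg(π)`: the least `c ≥ 0` for which `π` is `c`-regular
(the infimum is attained, see `isLeast_rg`). -/
noncomputable def rg {n : ℕ} (π : Fin n → ℤ) : ℝ :=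
  sInf {c : ℝ | 0 ≤ c ∧ IsRegular π c}

theorem isLeast_rg {n : ℕ} (π : Fin n → ℤ) :
    IsLeast {c : ℝ | 0 ≤ c ∧ IsRegular π c} (rg π) := by
  have hbdd : BddBelow {c : ℝ | 0 ≤ c ∧ IsRegular π c} := ⟨0, fun c hc => hc.1⟩
  have hne : {c : ℝ | 0 ≤ c ∧ IsRegular π c}.Nonempty := by
    refine ⟨∑ i, |(π i : ℝ) - mean π|, Finset.sum_nonneg fun i _ => abs_nonneg _, fun i => ?_⟩
    have h := Finset.single_le_sum (f := fun i => |(π i : ℝ) - mean π|)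
      (fun i _ => abs_nonneg _) (Finset.mem_univ i)
    have h' := abs_le.mp h
    constructor <;> linarith [h'.1, h'.2]
  refine ⟨⟨le_csInf hne fun c hc => hc.1, fun i => ⟨?_, ?_⟩⟩, fun c hc => csInf_le hbdd hc⟩
  · have : mean π - π i ≤ rg π := le_csInf hne fun c hc => by linarith [(hc.2 i).1]
    linarith
  · have : π i - mean π ≤ rg π := le_csInf hne fun c hc => by linarith [(hc.2 i).2]
    linarith

/-- The Erdős–Gallai inequality with index `k` for a nonincreasing sequence
`π 0 ≥ π 1 ≥ ⋯ ≥ π (n-1)`: the sum of the first `k` values is at most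
`k (k - 1)` plus the sum of `min (π i) k` over the remaining values. -/
def ErdosGallaiAt {n : ℕ} (π : Fin n → ℤ) (k : ℕ) : Prop :=
  ∑ i with i.val < k, π i ≤
    (k : ℤ) * ((k : ℤ) - 1) + ∑ i with k ≤ i.val, min (π i) (k : ℤ)

/-- The sequence `((m + c)^{n/2}, (m - c)^{n/2})` of even length `n`. -/
def twoValue (n : ℕ) (m c : ℤ) : Fin n → ℤ :=
  fun i => if i.val < n / 2 then m + c else m - c

end DegSeq

/-! Part (A) rests on the sufficiency half of the Erdős–Gallai theorem, proved here by edge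
exchanges: a graph that meets the prescribed degrees before `r`, stays below them elsewhere, has no
edge after `r` and maximises the degree of `r` must meet the degree at `r`. Otherwise every exchange
fails, which makes the vertices up to `r` a clique and saturates the later ones
(`IsPartial.min_le_deg`), so that counting contradicts the inequality at `r + 1`.

The inequalities are then checked for values in an interval `[L, M]` centred at the mean
(`erdosGallaiAt_of_mem_Icc`). In the critical range of `k`, concavity puts `min x k` above its chord
on `[L, M]`, and the bound becomes linear in the sum of the first `k` values. Complementation covers
means above `(n - 1) / 2`.

For (B), the two half-sums of the sequence differ by `n * c`, while in any graph the first half can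
exceed the second by at most `k * (k - 1)` with `k = n / 2`. -/

namespace DegSeq

/-! ### Degrees as integer sums, and single-edge surgery -/

open Classical in
/-- The degree of a vertex as an integer sum of adjacency indicators. -/
noncomputable def deg {n : ℕ} (G : SimpleGraph (Fin n)) (i : Fin n) : ℤ :=
  ∑ j, if G.Adj i j then 1 else 0

theorem deg_eq_degree {n : ℕ} (G : SimpleGraph (Fin n)) [DecidableRel G.Adj] (i : Fin n) :
    deg G i = G.degree i := by
  classical
  rw [deg, ← SimpleGraph.card_neighborFinset_eq_degree, SimpleGraph.neighborFinset_eq_filter,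
    Finset.card_filter]
  push_cast
  exact Finset.sum_congr rfl fun j _ => by congr

theorem graphic_iff {n : ℕ} {π : Fin n → ℤ} : Graphic π ↔ ∃ G, ∀ i, deg G i = π i := by
  classical
  constructor
  · rintro ⟨G, _, h⟩
    exact ⟨G, fun i => (deg_eq_degree G i).trans (h i)⟩
  · rintro ⟨G, h⟩
    exact ⟨G, inferInstance, fun i => (deg_eq_degree G i).symm.trans (h i)⟩

theorem even_sum_deg {n : ℕ} (G : SimpleGraph (Fin n)) : Even (∑ i, deg G i) := by
  classical
  have h := G.sum_degrees_eq_twice_card_edges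
  refine ⟨(G.edgeFinset.card : ℤ), ?_⟩
  rw [Finset.sum_congr rfl fun i _ => deg_eq_degree G i, ← Nat.cast_sum, h]
  push_cast
  ring

/-- The graph `G` with the edge `uv` added. -/
def addEdge {n : ℕ} (G : SimpleGraph (Fin n)) (u v : Fin n) : SimpleGraph (Fin n) where
  Adj a b := G.Adj a b ∨ (u ≠ v ∧ ((a = u ∧ b = v) ∨ (a = v ∧ b = u)))
  symm := ⟨fun a b h => by
    rcases h with h | ⟨h, h' | h'⟩
    · exact Or.inl h.symm
    · exact Or.inr ⟨h, Or.inr ⟨h'.2, h'.1⟩⟩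
    · exact Or.inr ⟨h, Or.inl ⟨h'.2, h'.1⟩⟩⟩
  loopless := ⟨fun a h => by
    rcases h with h | ⟨h, h' | h'⟩
    · exact G.loopless.irrefl a h
    · exact h (h'.1.symm.trans h'.2)
    · exact h (h'.2.symm.trans h'.1)⟩

/-- The graph `G` with the edge `uv` removed. -/
def delEdge {n : ℕ} (G : SimpleGraph (Fin n)) (u v : Fin n) : SimpleGraph (Fin n) where
  Adj a b := G.Adj a b ∧ ¬ ((a = u ∧ b = v) ∨ (a = v ∧ b = u))
  symm := ⟨fun a b h => ⟨h.1.symm, fun h' => h.2 (by tauto)⟩⟩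
  loopless := ⟨fun a h => G.loopless.irrefl a h.1⟩

theorem addEdge_adj {n : ℕ} {G : SimpleGraph (Fin n)} {u v a b : Fin n} :
    (addEdge G u v).Adj a b ↔ G.Adj a b ∨ (u ≠ v ∧ ((a = u ∧ b = v) ∨ (a = v ∧ b = u))) :=
  Iff.rfl

theorem delEdge_adj {n : ℕ} {G : SimpleGraph (Fin n)} {u v a b : Fin n} :
    (delEdge G u v).Adj a b ↔ G.Adj a b ∧ ¬ ((a = u ∧ b = v) ∨ (a = v ∧ b = u)) :=
  Iff.rfl

theorem deg_addEdge {n : ℕ} {G : SimpleGraph (Fin n)} {u v : Fin n} (huv : u ≠ v)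
    (h : ¬ G.Adj u v) (i : Fin n) :
    deg (addEdge G u v) i = deg G i + (if i = u then 1 else 0) + (if i = v then 1 else 0) := by
  classical
  have key : ∀ j, (if (addEdge G u v).Adj i j then (1 : ℤ) else 0) =
      (if G.Adj i j then 1 else 0) + (if j = v then (if i = u then 1 else 0) else 0)
        + (if j = u then (if i = v then 1 else 0) else 0) := by
    intro j
    have h' : ¬ G.Adj v u := fun h' => h h'.symm
    simp only [addEdge_adj]
    split_ifs <;> simp_all
  rw [deg, Finset.sum_congr rfl fun j _ => key j, Finset.sum_add_distrib, Finset.sum_add_distrib,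
    Finset.sum_ite_eq' Finset.univ v, Finset.sum_ite_eq' Finset.univ u, deg]
  simp only [Finset.mem_univ, if_true]

theorem deg_delEdge {n : ℕ} {G : SimpleGraph (Fin n)} {u v : Fin n} (h : G.Adj u v) (i : Fin n) :
    deg (delEdge G u v) i = deg G i - (if i = u then 1 else 0) - (if i = v then 1 else 0) := by
  have huv : u ≠ v := h.ne
  have hn : ¬ (delEdge G u v).Adj u v := fun h' => h'.2 (Or.inl ⟨rfl, rfl⟩)
  have hG : addEdge (delEdge G u v) u v = G := by
    ext a b
    simp only [addEdge_adj, delEdge_adj]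
    constructor
    · rintro (h' | ⟨-, ⟨rfl, rfl⟩ | ⟨rfl, rfl⟩⟩)
      exacts [h'.1, h, h.symm]
    · intro h'
      tauto
  have := deg_addEdge huv hn i
  rw [hG] at this
  linarith

/-- A vertex of larger degree has a private neighbour. -/
theorem exists_adj_not_adj {n : ℕ} {G : SimpleGraph (Fin n)} {i r : Fin n}
    (h : deg G r < deg G i) : ∃ u, G.Adj i u ∧ ¬ G.Adj r u ∧ u ≠ r := by
  classical
  by_contra! hc
  refine absurd h (not_lt.mpr ?_)
  -- Reindexing by the swap pairs the possible edge `ir` with itself, so the two indicator sums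
  -- compare termwise.
  rw [deg, deg, ← Equiv.sum_comp (Equiv.swap i r)]
  refine Finset.sum_le_sum fun j _ => ?_
  have hj := hc (Equiv.swap i r j)
  by_cases hA : G.Adj i (Equiv.swap i r j)
  · rw [if_pos hA]
    by_cases hji : j = i
    · subst hji
      rw [Equiv.swap_apply_left] at hA
      rw [if_pos hA.symm]
    · by_cases hjr : j = r
      · subst hjr
        rw [Equiv.swap_apply_right] at hA
        exact absurd hA (G.loopless.irrefl i)
      · rw [Equiv.swap_apply_of_ne_of_ne hji hjr] at hA hj
        rw [if_pos]
        by_contra h'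
        exact hjr (hj hA h')
  · rw [if_neg hA]
    split_ifs <;> simp

/-! ### Counting edges across the cut at index `k` -/

theorem card_filter_val_lt {n k : ℕ} (hk : k ≤ n) :
    (Finset.univ.filter fun i : Fin n => i.val < k).card = k := by
  rw [Fin.card_filter_val_lt]
  exact min_eq_right hk

theorem card_filter_le_val {n k : ℕ} (hk : k ≤ n) :
    ((Finset.univ.filter fun i : Fin n => k ≤ i.val).card : ℤ) = n - k := by
  have h := Finset.card_filter_add_card_filter_not (s := (Finset.univ : Finset (Fin n)))
    (fun i : Fin n => i.val < k)
  simp only [not_lt] at h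
  rw [card_filter_val_lt hk, Finset.card_univ, Fintype.card_fin] at h
  omega

theorem sum_lt_add_sum_ge {n : ℕ} {R : Type*} [AddCommMonoid R] (f : Fin n → R) (k : ℕ) :
    ∑ i with i.val < k, f i + ∑ i with k ≤ i.val, f i = ∑ i, f i := by
  have := Finset.sum_filter_add_sum_filter_not Finset.univ (fun i : Fin n => i.val < k) f
  simpa only [not_lt] using this

open Classical in
/-- Count the degrees of the first `k` vertices by the position of the other end. -/
theorem sum_deg_lt {n : ℕ} (G : SimpleGraph (Fin n)) (k : ℕ) :
    ∑ i with i.val < k, deg G i =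
      ∑ i : Fin n with i.val < k, ∑ j : Fin n with j.val < k, (if G.Adj i j then (1 : ℤ) else 0) +
      ∑ j : Fin n with k ≤ j.val, ∑ i : Fin n with i.val < k, (if G.Adj j i then (1 : ℤ) else 0) := by
  rw [Finset.sum_comm (s := Finset.univ.filter fun j : Fin n => k ≤ j.val),
    ← Finset.sum_add_distrib]
  refine Finset.sum_congr rfl fun i _ => ?_
  rw [deg, ← sum_lt_add_sum_ge _ k]
  congr 1
  exact Finset.sum_congr rfl fun j _ => by simp only [G.adj_comm]

theorem sum_ite_ne_lt {n k : ℕ} (hk : k ≤ n) :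
    ∑ i : Fin n with i.val < k, ∑ j : Fin n with j.val < k, (if i ≠ j then (1 : ℤ) else 0) =
      k * (k - 1) := by
  have h : ∀ i ∈ Finset.univ.filter (fun i : Fin n => i.val < k),
      ∑ j : Fin n with j.val < k, (if i ≠ j then (1 : ℤ) else 0) = k - 1 := by
    intro i hi
    have : ∀ j, (if i ≠ j then (1 : ℤ) else 0) = 1 - (if i = j then 1 else 0) := by
      intro j
      split_ifs <;> simp_all
    rw [Finset.sum_congr rfl fun j _ => this j, Finset.sum_sub_distrib, Finset.sum_ite_eq,
      if_pos hi, Finset.sum_const, card_filter_val_lt hk]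
    simp
  rw [Finset.sum_congr rfl h, Finset.sum_const, card_filter_val_lt hk]
  simp

/-- A weak form of Erdős–Gallai necessity, without the minimum with `k`; it suffices to refute
graphicality of the two-valued sequence. -/
theorem sum_deg_lt_le {n k : ℕ} (hk : k ≤ n) (G : SimpleGraph (Fin n)) :
    ∑ i with i.val < k, deg G i ≤ (k : ℤ) * (k - 1) + ∑ i with k ≤ i.val, deg G i := by
  classical
  rw [sum_deg_lt, ← sum_ite_ne_lt hk]
  refine add_le_add (Finset.sum_le_sum fun i _ => Finset.sum_le_sum fun j _ => ?_)
    (Finset.sum_le_sum fun j _ => ?_)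
  · by_cases h : G.Adj i j
    · simp [h, h.ne]
    · rw [if_neg h]
      split_ifs <;> simp
  · rw [deg]
    exact Finset.sum_le_sum_of_subset_of_nonneg (Finset.filter_subset _ _)
      fun _ _ _ => by split_ifs <;> simp

/-! ### Sufficiency of the Erdős–Gallai inequalities -/

/-- `G` has degrees at most `d`, with equality before `r`, and is edgeless after `r`. -/
structure IsPartial {n : ℕ} (d : Fin n → ℤ) (r : Fin n) (G : SimpleGraph (Fin n)) : Prop where
  le : ∀ i, deg G i ≤ d i
  eq : ∀ i < r, deg G i = d i
  indep : ∀ i j, r < i → r < j → ¬ G.Adj i j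

section Maximal

variable {n : ℕ} {d : Fin n → ℤ} {r : Fin n} {G : SimpleGraph (Fin n)}

/-- Otherwise the edge `rk` could simply be added, against maximality at `r`. -/
theorem IsPartial.adj_of_lt (hG : IsPartial d r G)
    (hmax : ∀ H, IsPartial d r H → deg H r ≤ deg G r) (hr : deg G r < d r)
    {k : Fin n} (hrk : r < k) (hk : deg G k < d k) : G.Adj r k := by
  by_contra hA
  have hdeg := deg_addEdge hrk.ne hA
  have hH : IsPartial d r (addEdge G r k) := by
    refine ⟨fun i => ?_, fun i hi => ?_, fun i j hi hj h => ?_⟩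
    · have := hG.le i
      rw [hdeg]
      split_ifs <;> subst_vars <;> omega
    · rw [hdeg, if_neg hi.ne, if_neg (hi.trans hrk).ne, hG.eq i hi]
      simp
    · have := hG.indep i j hi hj
      rw [addEdge_adj] at h
      grind
  have hle := hmax _ hH
  rw [hdeg, if_pos rfl, if_neg hrk.ne] at hle
  omega

theorem IsPartial.exists_private (hd : Antitone d) (hG : IsPartial d r G) (hr : deg G r < d r)
    {i : Fin n} (hi : i < r) : ∃ u, G.Adj i u ∧ ¬ G.Adj r u ∧ u ≠ r := by
  apply exists_adj_not_adj
  rw [hG.eq i hi]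
  exact hr.trans_le (hd hi.le)

/-- With `u` a private neighbour of `i`, replacing `iu` by `ur` and `ir` changes only the degree of
`r`, by two. If `r` lacks just one, parity supplies a deficient `k` after `r`, and deleting `rk` as
well leaves a net gain of one. -/
theorem IsPartial.adj_of_gt (hd : Antitone d) (hs : Even (∑ i, d i)) (hG : IsPartial d r G)
    (hmax : ∀ H, IsPartial d r H → deg H r ≤ deg G r) (hr : deg G r < d r)
    {i : Fin n} (hi : i < r) : G.Adj i r := by
  by_contra hA
  obtain ⟨u, hiu, hru, hur⟩ := hG.exists_private hd hr hi
  have h1 := deg_delEdge hiu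
  have h2 : ∀ j, deg (addEdge (delEdge G i u) u r) j = _ := deg_addEdge hur (fun h => hru h.1.symm)
  have h3 : ∀ j, deg (addEdge (addEdge (delEdge G i u) u r) i r) j = _ :=
    deg_addEdge hi.ne (by
      have := hiu.ne
      simp only [addEdge_adj, delEdge_adj]
      grind)
  simp only [h1, h2] at h3
  have hiu' := hiu.ne
  by_cases hgap : deg G r + 2 ≤ d r
  · have hH : IsPartial d r (addEdge (addEdge (delEdge G i u) u r) i r) := by
      refine ⟨fun j => ?_, fun j hj => ?_, fun j k hj hk h => ?_⟩
      · have := hG.le j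
        rw [h3]
        split_ifs <;> subst_vars <;> omega
      · have := hG.eq j hj
        have := hj.ne
        rw [h3]
        split_ifs <;> subst_vars <;> omega
      · have := hG.indep j k hj hk
        simp only [addEdge_adj, delEdge_adj] at h
        grind
    have hle := hmax _ hH
    rw [h3] at hle
    split_ifs at hle <;> subst_vars <;> omega
  · obtain ⟨k, hkr, hk⟩ : ∃ k, r < k ∧ deg G k < d k := by
      by_contra! hc
      -- If no later vertex were deficient, the total deficiency would be exactly one, but both sums
      -- are even.
      have hsum : ∑ j, d j = ∑ j, deg G j + 1 := by
        have : ∀ j, d j = deg G j + if j = r then 1 else 0 := by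
          intro j
          have := hG.le j
          rcases lt_trichotomy j r with h | h | h
          · rw [if_neg h.ne, hG.eq j h, add_zero]
          · subst h
            rw [if_pos rfl]
            omega
          · have := hc j h
            rw [if_neg h.ne']
            omega
        rw [Finset.sum_congr rfl fun j _ => this j, Finset.sum_add_distrib]
        simp
      have := even_sum_deg G
      grind
    have hrk := hG.adj_of_lt hmax hr hkr hk
    have huk : u ≠ k := fun h => hru (h ▸ hrk)
    have hik : i ≠ k := (hi.trans hkr).ne
    have h4 : ∀ j, deg (delEdge (addEdge (addEdge (delEdge G i u) u r) i r) r k) j = _ :=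
      deg_delEdge (by
        simp only [addEdge_adj, delEdge_adj]
        grind)
    simp only [h3] at h4
    have hH : IsPartial d r (delEdge (addEdge (addEdge (delEdge G i u) u r) i r) r k) := by
      refine ⟨fun j => ?_, fun j hj => ?_, fun j l hj hl h => ?_⟩
      · have := hG.le j
        rw [h4]
        split_ifs <;> subst_vars <;> omega
      · have := hG.eq j hj
        have := hj.ne
        have := (hj.trans hkr).ne
        rw [h4]
        split_ifs <;> subst_vars <;> omega
      · have := hG.indep j l hj hl
        simp only [addEdge_adj, delEdge_adj] at h
        grind
    have hle := hmax _ hH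
    rw [h4] at hle
    have := hkr.ne
    split_ifs at hle <;> subst_vars <;> omega

open Classical in
theorem IsPartial.deg_eq_of_lt (hG : IsPartial d r G) {k : Fin n} (hk : r < k) :
    deg G k = ∑ i : Fin n with i.val < r.val + 1, (if G.Adj k i then (1 : ℤ) else 0) := by
  rw [deg, ← sum_lt_add_sum_ge _ (r.val + 1), add_eq_left]
  refine Finset.sum_eq_zero fun j hj => if_neg (hG.indep k j hk ?_)
  exact Fin.lt_def.mpr (Finset.mem_filter.mp hj).2

/-- A deficient `k` after `r` that misses some `i` up to `r` would allow replacing `iu` by `ur` and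
`ik`: only `r` and `k` gain, by one each. -/
theorem IsPartial.min_le_deg (hd : Antitone d) (hG : IsPartial d r G)
    (hmax : ∀ H, IsPartial d r H → deg H r ≤ deg G r) (hr : deg G r < d r)
    {k : Fin n} (hk : r < k) : min (d k) ((r.val + 1 : ℕ) : ℤ) ≤ deg G k := by
  classical
  by_contra! hlt
  obtain ⟨hlt, hlt'⟩ := lt_min_iff.mp hlt
  have hrk := hG.adj_of_lt hmax hr hk hlt
  obtain ⟨i, hi, hki⟩ : ∃ i, i ≤ r ∧ ¬ G.Adj k i := by
    by_contra! hc
    rw [hG.deg_eq_of_lt hk, Finset.sum_congr rfl fun i hi => if_pos (hc i ?_), Finset.sum_const,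
      card_filter_val_lt (by omega)] at hlt'
    · simp at hlt'
    · have := (Finset.mem_filter.mp hi).2
      exact Fin.le_def.mpr (by omega)
  have hir : i < r := lt_of_le_of_ne hi fun h => hki (h ▸ hrk.symm)
  obtain ⟨u, hiu, hru, hur⟩ := hG.exists_private hd hr hir
  have hiu' := hiu.ne
  have hik := (hir.trans hk).ne
  have huk : u ≠ k := fun h => hru (h ▸ hrk)
  have h1 := deg_delEdge hiu
  have h2 : ∀ j, deg (addEdge (delEdge G i u) u r) j = _ := deg_addEdge hur (fun h => hru h.1.symm)
  have h3 : ∀ j, deg (addEdge (addEdge (delEdge G i u) u r) i k) j = _ :=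
    deg_addEdge hik (by
      have := G.adj_comm k i
      simp only [addEdge_adj, delEdge_adj]
      grind)
  simp only [h1, h2] at h3
  have hH : IsPartial d r (addEdge (addEdge (delEdge G i u) u r) i k) := by
    refine ⟨fun j => ?_, fun j hj => ?_, fun j l hj hl h => ?_⟩
    · have := hG.le j
      rw [h3]
      split_ifs <;> subst_vars <;> omega
    · have := hG.eq j hj
      have := hj.ne
      have := (hj.trans hk).ne
      rw [h3]
      split_ifs <;> subst_vars <;> omega
    · have := hG.indep j l hj hl
      simp only [addEdge_adj, delEdge_adj] at h
      grind
  have hle := hmax _ hH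
  rw [h3] at hle
  have := hk.ne
  split_ifs at hle <;> subst_vars <;> omega

/-- The private neighbours `u` of `i` and `w` of `j` lie after `r` and may coincide. Replacing `iu`
and `jw` by `ij` and `ur` raises `r` at the sole cost of `w`, where a loss is allowed. -/
theorem IsPartial.adj_of_lt_lt (hd : Antitone d) (hs : Even (∑ i, d i)) (hG : IsPartial d r G)
    (hmax : ∀ H, IsPartial d r H → deg H r ≤ deg G r) (hr : deg G r < d r)
    {i j : Fin n} (hi : i < r) (hj : j < r) (hij : i ≠ j) : G.Adj i j := by
  by_contra hA
  obtain ⟨u, hiu, hru, hur⟩ := hG.exists_private hd hr hi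
  obtain ⟨w, hjw, hrw, hwr⟩ := hG.exists_private hd hr hj
  have hu : r < u := lt_of_le_of_ne
    (not_lt.mp fun h => hru (hG.adj_of_gt hd hs hmax hr h).symm) hur.symm
  have hw : r < w := lt_of_le_of_ne
    (not_lt.mp fun h => hrw (hG.adj_of_gt hd hs hmax hr h).symm) hwr.symm
  have hiu' := (hi.trans hu).ne
  have hju := (hj.trans hu).ne
  have hiw := (hi.trans hw).ne
  have hjw' := (hj.trans hw).ne
  have h1 := deg_delEdge hiu
  have h2 : ∀ l, deg (delEdge (delEdge G i u) j w) l = _ := deg_delEdge (by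
    simp only [delEdge_adj]
    grind)
  have h3 : ∀ l, deg (addEdge (delEdge (delEdge G i u) j w) i j) l = _ :=
    deg_addEdge hij fun h => hA h.1.1
  have h4 : ∀ l, deg (addEdge (addEdge (delEdge (delEdge G i u) j w) i j) u r) l = _ :=
    deg_addEdge hur (by
      have := G.adj_comm u r
      simp only [addEdge_adj, delEdge_adj]
      grind)
  simp only [h1, h2, h3] at h4
  have hH : IsPartial d r (addEdge (addEdge (delEdge (delEdge G i u) j w) i j) u r) := by
    refine ⟨fun l => ?_, fun l hl => ?_, fun l m hl hm h => ?_⟩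
    · have := hG.le l
      rw [h4]
      split_ifs <;> subst_vars <;> omega
    · have := hG.eq l hl
      have := hl.ne
      have := (hl.trans hu).ne
      have := (hl.trans hw).ne
      rw [h4]
      split_ifs <;> subst_vars <;> omega
    · have := hG.indep l m hl hm
      simp only [addEdge_adj, delEdge_adj] at h
      grind
  have hle := hmax _ hH
  have := hi.ne
  have := hj.ne
  rw [h4] at hle
  split_ifs at hle <;> subst_vars <;> omega

theorem IsPartial.deg_eq (hd : Antitone d) (hs : Even (∑ i, d i))
    (hEG : ErdosGallaiAt d (r.val + 1)) (hG : IsPartial d r G)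
    (hmax : ∀ H, IsPartial d r H → deg H r ≤ deg G r) : deg G r = d r := by
  classical
  by_contra hne
  have hr := lt_of_le_of_ne (hG.le r) hne
  have hcl : ∀ i j : Fin n, i.val < r.val + 1 → j.val < r.val + 1 → (G.Adj i j ↔ i ≠ j) := by
    intro i j hi hj
    refine ⟨fun h => h.ne, fun h => ?_⟩
    rcases (Fin.le_def.mpr (Nat.lt_succ_iff.mp hi) : i ≤ r).lt_or_eq with hi' | rfl
    · rcases (Fin.le_def.mpr (Nat.lt_succ_iff.mp hj) : j ≤ r).lt_or_eq with hj' | rfl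
      · exact hG.adj_of_lt_lt hd hs hmax hr hi' hj' h
      · exact hG.adj_of_gt hd hs hmax hr hi'
    · rcases (Fin.le_def.mpr (Nat.lt_succ_iff.mp hj) : j ≤ i).lt_or_eq with hj' | rfl
      · exact (hG.adj_of_gt hd hs hmax hr hj').symm
      · exact absurd rfl h
  have hsum := sum_deg_lt G (r.val + 1)
  have e1 : ∑ i : Fin n with i.val < r.val + 1, ∑ j : Fin n with j.val < r.val + 1,
      (if G.Adj i j then (1 : ℤ) else 0) = ((r.val + 1 : ℕ) : ℤ) * (((r.val + 1 : ℕ) : ℤ) - 1) := by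
    rw [← sum_ite_ne_lt (n := n) (by omega)]
    refine Finset.sum_congr rfl fun i hi => Finset.sum_congr rfl fun j hj => ?_
    simp only [hcl i j (Finset.mem_filter.mp hi).2 (Finset.mem_filter.mp hj).2]
  have e2 : ∑ k : Fin n with r.val + 1 ≤ k.val, min (d k) ((r.val + 1 : ℕ) : ℤ) ≤
      ∑ k : Fin n with r.val + 1 ≤ k.val, ∑ i : Fin n with i.val < r.val + 1,
        (if G.Adj k i then (1 : ℤ) else 0) := by
    refine Finset.sum_le_sum fun k hk => ?_
    have hk : r < k := Fin.lt_def.mpr (Finset.mem_filter.mp hk).2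
    rw [← hG.deg_eq_of_lt hk]
    exact hG.min_le_deg hd hmax hr hk
  -- By `e1` and `e2` the left side is at least the Erdős–Gallai bound, which by `hEG` is at least
  -- the right side.
  have e3 : ∑ i : Fin n with i.val < r.val + 1, deg G i < ∑ i : Fin n with i.val < r.val + 1, d i :=
    Finset.sum_lt_sum (fun i _ => hG.le i) ⟨r, by simp, hr⟩
  rw [ErdosGallaiAt] at hEG
  linarith

end Maximal

/-- The Erdős–Gallai theorem (sufficiency). -/
theorem graphic_of_erdosGallaiAt {n : ℕ} {d : Fin n → ℤ} (hd : Antitone d) (h0 : ∀ i, 0 ≤ d i)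
    (hs : Even (∑ i, d i)) (hEG : ∀ k, 1 ≤ k → k ≤ n → ErdosGallaiAt d k) : Graphic d := by
  have key : ∀ k ≤ n, ∃ G : SimpleGraph (Fin n), (∀ i, deg G i ≤ d i) ∧
      (∀ i : Fin n, i.val < k → deg G i = d i) ∧
      ∀ i j : Fin n, k ≤ i.val → k ≤ j.val → ¬ G.Adj i j := by
    intro k
    induction k with
    | zero =>
      intro _
      refine ⟨⊥, fun i => ?_, fun i hi => absurd hi (Nat.not_lt_zero _), fun i j _ _ h => h⟩
      simpa [deg] using h0 i
    | succ k ih =>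
      intro hk
      obtain ⟨G, hle, heq, hind⟩ := ih (by omega)
      let r : Fin n := ⟨k, hk⟩
      have hG : IsPartial d r G := ⟨hle, fun i hi => heq i hi, fun i j hi hj =>
        hind i j (Fin.lt_def.mp hi).le (Fin.lt_def.mp hj).le⟩
      obtain ⟨H, hH, hmax⟩ := Set.exists_max_image {H | IsPartial d r H} (fun H => deg H r)
        (Set.toFinite _) ⟨G, hG⟩
      -- Edges at `r` itself are permitted in `IsPartial`, so a maximiser is exactly a solution for
      -- `k + 1`.
      have hr := IsPartial.deg_eq hd hs (hEG _ (by omega) hk) hH hmax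
      refine ⟨H, hH.le, fun i hi => ?_, fun i j hi hj => hH.indep i j hi hj⟩
      rcases (Fin.le_def.mpr (Nat.lt_succ_iff.mp hi) : i ≤ r).lt_or_eq with h | h
      · exact hH.eq i h
      · rw [h, hr]
  obtain ⟨G, -, h, -⟩ := key n le_rfl
  exact graphic_iff.mpr ⟨G, fun i => h i i.isLt⟩

theorem Graphic.of_comp {n : ℕ} {π : Fin n → ℤ} (σ : Equiv.Perm (Fin n))
    (h : Graphic (π ∘ σ)) : Graphic π := by
  classical
  obtain ⟨G, hG⟩ := graphic_iff.mp h
  refine graphic_iff.mpr ⟨G.comap σ.symm, fun i => ?_⟩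
  have := hG (σ.symm i)
  rw [Function.comp_apply, Equiv.apply_symm_apply] at this
  rw [← this, deg, deg]
  simp only [SimpleGraph.comap_adj]
  exact Equiv.sum_comp σ.symm fun j => if G.Adj (σ.symm i) j then (1 : ℤ) else 0

theorem Graphic.of_compl {n : ℕ} {π : Fin n → ℤ}
    (h : Graphic fun i => (n : ℤ) - 1 - π i) : Graphic π := by
  classical
  obtain ⟨G, _, hG⟩ := h
  refine ⟨Gᶜ, inferInstance, fun i => ?_⟩
  have h1 := G.degree_compl i
  have h2 := G.degree_lt_card_verts i
  have h3 : (G.degree i : ℤ) = (n : ℤ) - 1 - π i := hG i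
  rw [Fintype.card_fin] at h1 h2
  omega

/-! ### Erdős–Gallai inequalities from closeness to the mean -/

/-- The Erdős–Gallai inequalities hold for values in a short interval `[L, M]` centred at the
mean value. -/
theorem erdosGallaiAt_of_mem_Icc {n k : ℕ} {d : Fin n → ℤ} {L M : ℝ} (h0 : ∀ i, 0 ≤ d i)
    (hn : ∀ i, d i ≤ (n : ℤ) - 1) (hLM : ∀ i, L ≤ d i ∧ (d i : ℝ) ≤ M)
    (hs : ((∑ i, d i : ℤ) : ℝ) = (L + M) / 2 * n) (hL : 0 ≤ L) (hD : 2 * (M - L) + 2 ≤ n)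
    (hc : L = 0 ∨ 2 * (M - L) + 2 = n ∧ 4 * L ≤ n) (h1k : 1 ≤ k) (hk : k ≤ n) :
    ErdosGallaiAt d k := by
  have hk1 : (1 : ℝ) ≤ k := by exact_mod_cast h1k
  have hkn : (k : ℝ) ≤ n := by exact_mod_cast hk
  have hc1 := card_filter_val_lt hk
  have hc2 := card_filter_le_val hk
  rw [ErdosGallaiAt]
  by_cases hall : ∀ i, d i ≤ (k : ℤ) - 1
  · have e1 : ∑ i with i.val < k, d i ≤ (k : ℤ) * ((k : ℤ) - 1) := by
      have := Finset.sum_le_card_nsmul (Finset.univ.filter fun i : Fin n => i.val < k) d _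
        fun i _ => hall i
      rwa [hc1, nsmul_eq_mul] at this
    have e2 : 0 ≤ ∑ i with k ≤ i.val, min (d i) (k : ℤ) :=
      Finset.sum_nonneg fun i _ => le_min (h0 i) (by positivity)
    linarith
  push Not at hall
  obtain ⟨i₀, hi₀⟩ := hall
  have hkM : (k : ℝ) ≤ M := by
    have : (k : ℤ) ≤ d i₀ := by omega
    exact le_trans (by exact_mod_cast this) (hLM i₀).2
  rcases le_or_gt (k : ℝ) L with hkL | hkL
  · have e1 : ∑ i with i.val < k, d i ≤ (k : ℤ) * ((n : ℤ) - 1) := by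
      have := Finset.sum_le_card_nsmul (Finset.univ.filter fun i : Fin n => i.val < k) d _
        fun i _ => hn i
      rwa [hc1, nsmul_eq_mul] at this
    have e2 : ∑ i with k ≤ i.val, min (d i) (k : ℤ) = ((n : ℤ) - k) * k := by
      rw [Finset.sum_congr rfl fun i _ => min_eq_right (a := d i) (b := (k : ℤ)) ?_,
        Finset.sum_const, nsmul_eq_mul, hc2]
      exact_mod_cast hkL.trans (hLM i).1
    rw [e2]
    linarith
  have hsum := sum_lt_add_sum_ge (fun i => (d i : ℝ)) k
  rw [← Int.cast_sum Finset.univ, hs] at hsum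
  have hc1' : ((Finset.univ.filter fun i : Fin n => i.val < k).card : ℝ) = k := by rw [hc1]
  have hc2' : ((Finset.univ.filter fun i : Fin n => k ≤ i.val).card : ℝ) = n - k := by
    exact_mod_cast hc2
  have hS1 : ∑ i with i.val < k, (d i : ℝ) ≤ k * M := by
    have := Finset.sum_le_card_nsmul (Finset.univ.filter fun i : Fin n => i.val < k)
      (fun i => (d i : ℝ)) _ fun i _ => (hLM i).2
    rwa [nsmul_eq_mul, hc1'] at this
  have hS2 : (n - k) * L ≤ ∑ i with k ≤ i.val, (d i : ℝ) := by
    have := Finset.card_nsmul_le_sum (Finset.univ.filter fun i : Fin n => k ≤ i.val)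
      (fun i => (d i : ℝ)) _ fun i _ => (hLM i).1
    rwa [nsmul_eq_mul, hc2'] at this
  have hT : (n - k) * L ≤ ∑ i with k ≤ i.val, min (d i : ℝ) k := by
    have := Finset.card_nsmul_le_sum (Finset.univ.filter fun i : Fin n => k ≤ i.val)
      (fun i => min (d i : ℝ) k) L fun i _ => le_min (hLM i).1 hkL.le
    rwa [nsmul_eq_mul, hc2'] at this
  -- Here `L < k ≤ M`: the concave function `min x k` lies above its chord from `(L, L)` to `(M,
  -- k)`. Denominators are cleared by `M - L`.
  have hchord : (M - L) * ((n - k) * L) + (k - L) * (∑ i with k ≤ i.val, (d i : ℝ) - (n - k) * L) ≤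
      (M - L) * ∑ i with k ≤ i.val, min (d i : ℝ) k := by
    have hpt : ∀ i : Fin n, (M - L) * L + (k - L) * ((d i : ℝ) - L) ≤ (M - L) * min (d i : ℝ) k := by
      intro i
      obtain ⟨h1, h2⟩ := hLM i
      rcases le_total (d i : ℝ) k with h | h
      · rw [min_eq_left h]
        nlinarith [mul_nonneg (sub_nonneg.mpr h1) (sub_nonneg.mpr hkM)]
      · rw [min_eq_right h]
        nlinarith [mul_nonneg (sub_nonneg.mpr h2) (sub_nonneg.mpr hkL.le)]
    have := Finset.sum_le_sum fun i (_ : i ∈ Finset.univ.filter fun i : Fin n => k ≤ i.val) => hpt i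
    rw [← Finset.mul_sum, Finset.sum_add_distrib, ← Finset.mul_sum, ← Finset.mul_sum,
      Finset.sum_sub_distrib, Finset.sum_const, nsmul_eq_mul, hc2'] at this
    linarith
  suffices h : ∑ i with i.val < k, (d i : ℝ) ≤
      (k : ℝ) * ((k : ℝ) - 1) + ∑ i with k ≤ i.val, min (d i : ℝ) k by
    exact_mod_cast h
  generalize ∑ i with i.val < k, (d i : ℝ) = S₁ at *
  generalize ∑ i with k ≤ i.val, (d i : ℝ) = S₂ at *
  generalize ∑ i with k ≤ i.val, min (d i : ℝ) k = T at *
  have hDpos : 0 < M - L := by linarith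
  by_cases hkD : 0 ≤ L * (M - L + 1 - k)
  · have hS₂ : S₂ = (L + M) / 2 * n - S₁ := by linarith
    subst hS₂
    -- The slack of the chord bound is `f1 + f2 + f3`: `f3` pays for replacing `S₁` by its maximum
    -- `k * M`, `f2` for replacing `n` by `2 * (M - L) + 2`, and `f1` is what remains.
    have f1 : 0 ≤ (M - L) * (L * (M - L + 1 - k)) := mul_nonneg hDpos.le hkD
    have f2 : 0 ≤ (n - (2 * (M - L) + 2)) * (L * (M - k) + (k - L) * ((L + M) / 2)) :=
      mul_nonneg (by linarith) (add_nonneg (mul_nonneg hL (by linarith))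
        (mul_nonneg (by linarith) (by linarith)))
    have f3 : 0 ≤ (M - L + (k - L)) * (k * M - S₁) :=
      mul_nonneg (by linarith) (by linarith)
    have f4 : (M - L) * S₁ ≤ (M - L) * ((k : ℝ) * ((k : ℝ) - 1) + T) := by linarith
    exact le_of_mul_le_mul_left f4 hDpos
  · have hL0 : L ≠ 0 := fun h => hkD (by rw [h, zero_mul])
    obtain ⟨hn', hL4⟩ := hc.resolve_left hL0
    have hkD' : M - L + 1 < k := by
      by_contra! h
      exact hkD (mul_nonneg hL (by linarith))
    -- For such large `k` the crude bounds `hS2` and `hT` suffice; with `n = 2 * (M - L) + 2` their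
    -- slack is this product. Its second factor is nonnegative since `4 * L ≤ n` gives `2 * L ≤ M -
    -- L + 1 < k`.
    have h : 0 ≤ (k - (M - L + 1)) * (k + (M - L) - 2 * L) :=
      mul_nonneg (by linarith) (by linarith)
    rw [← hn'] at hS2 hT hsum
    linarith

theorem graphic_of_mem_Icc {n : ℕ} {π : Fin n → ℤ} {L M : ℝ} (h0 : ∀ i, 0 ≤ π i)
    (hn : ∀ i, π i ≤ (n : ℤ) - 1) (heven : Even (∑ i, π i))
    (hLM : ∀ i, L ≤ π i ∧ (π i : ℝ) ≤ M)
    (hs : ((∑ i, π i : ℤ) : ℝ) = (L + M) / 2 * n) (hL : 0 ≤ L) (hD : 2 * (M - L) + 2 ≤ n)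
    (hc : L = 0 ∨ 2 * (M - L) + 2 = n ∧ 4 * L ≤ n) : Graphic π := by
  let σ : Equiv.Perm (Fin n) := Fin.revPerm.trans (Tuple.sort π)
  have hsum : ∑ i, (π ∘ σ) i = ∑ i, π i := Equiv.sum_comp σ π
  refine Graphic.of_comp σ (graphic_of_erdosGallaiAt ?_ (fun i => h0 _) (by rwa [hsum])
    fun k h1k hk => erdosGallaiAt_of_mem_Icc (fun i => h0 _) (fun i => hn _) (fun i => hLM _)
      (by rw [hsum, hs]) hL hD hc h1k hk)
  intro i j hij
  exact Tuple.monotone_sort π (Fin.rev_le_rev.mpr hij)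

theorem sum_eq_mean_mul {n : ℕ} [NeZero n] (π : Fin n → ℤ) :
    ((∑ i, π i : ℤ) : ℝ) = mean π * n := by
  rw [mean, div_mul_cancel₀ _ (Nat.cast_ne_zero.mpr (NeZero.ne n))]

/-- The interval has length `(n - 2) / 2`, and the upper bound on the mean is precisely `4 * L ≤ n`.
-/
theorem graphic_of_mean_le {n : ℕ} [NeZero n] {π : Fin n → ℤ} (h0 : ∀ i, 0 ≤ π i)
    (hn : ∀ i, π i ≤ (n : ℤ) - 1) (heven : Even (∑ i, π i))
    (hr : IsRegular π (((n : ℝ) - 2) / 4)) (h1 : ((n : ℝ) - 2) / 4 ≤ mean π)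
    (h2 : mean π ≤ ((n : ℝ) - 1) / 2) : Graphic π :=
  graphic_of_mem_Icc h0 hn heven hr (by rw [sum_eq_mean_mul]; ring) (by linarith)
    (by linarith) (Or.inr ⟨by ring, by linarith⟩)

theorem graphic_of_mean_lt {n : ℕ} [NeZero n] {π : Fin n → ℤ} (h0 : ∀ i, 0 ≤ π i)
    (hn : ∀ i, π i ≤ (n : ℤ) - 1) (heven : Even (∑ i, π i))
    (hr : IsRegular π (mean π)) (h1 : mean π < ((n : ℝ) - 2) / 4) : Graphic π :=
  graphic_of_mem_Icc h0 hn heven hr (by rw [sum_eq_mean_mul]; ring) (by linarith)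
    (by linarith) (Or.inl (by ring))

/-! ### Complementary sequences and regularity -/

theorem sum_compl {n : ℕ} (π : Fin n → ℤ) :
    ∑ i, ((n : ℤ) - 1 - π i) = n * (n - 1) - ∑ i, π i := by
  simp [Finset.sum_sub_distrib, mul_sub]

theorem even_sum_compl {n : ℕ} {π : Fin n → ℤ} (h : Even (∑ i, π i)) :
    Even (∑ i, ((n : ℤ) - 1 - π i)) := by
  rw [sum_compl]
  exact (Int.even_mul_pred_self n).sub h

theorem mean_compl {n : ℕ} [NeZero n] (π : Fin n → ℤ) :
    mean (fun i => (n : ℤ) - 1 - π i) = n - 1 - mean π := by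
  have hn : (n : ℝ) ≠ 0 := Nat.cast_ne_zero.mpr (NeZero.ne n)
  rw [mean, mean, sum_compl]
  push_cast
  field_simp

theorem IsRegular.compl {n : ℕ} [NeZero n] {π : Fin n → ℤ} {c : ℝ} (h : IsRegular π c) :
    IsRegular (fun i => (n : ℤ) - 1 - π i) c := by
  intro i
  rw [mean_compl]
  have := h i
  push_cast
  constructor <;> linarith

theorem isRegular_of_rg_le {n : ℕ} {π : Fin n → ℤ} {c : ℝ} (h : rg π ≤ c) : IsRegular π c :=
  fun i => by
    have := (isLeast_rg π).1.2 i
    constructor <;> linarith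

theorem rg_eq {n : ℕ} {π : Fin n → ℤ} {c : ℝ} (hc : 0 ≤ c) (h : ∀ i, |(π i : ℝ) - mean π| ≤ c)
    (hex : ∃ i, |(π i : ℝ) - mean π| = c) : rg π = c := by
  refine (isLeast_rg π).unique ⟨⟨hc, fun i => ?_⟩, fun b hb => ?_⟩
  · have := abs_le.mp (h i)
    constructor <;> linarith
  · obtain ⟨i, rfl⟩ := hex
    have := hb.2 i
    exact abs_le.mpr ⟨by linarith, by linarith⟩

/-! ### The extremal two-valued sequence, with `n = h + h` -/

section TwoValue

variable {h : ℕ} (m c : ℤ)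

theorem twoValue_of_lt {i : Fin (h + h)} (hi : i.val < h) : twoValue (h + h) m c i = m + c :=
  if_pos (by omega)

theorem twoValue_of_le {i : Fin (h + h)} (hi : h ≤ i.val) : twoValue (h + h) m c i = m - c :=
  if_neg (by omega)

theorem sum_twoValue_lt : ∑ i with i.val < h, twoValue (h + h) m c i = h * (m + c) := by
  rw [Finset.sum_congr rfl fun i hi => twoValue_of_lt m c (Finset.mem_filter.mp hi).2,
    Finset.sum_const, card_filter_val_lt (by omega), nsmul_eq_mul]

theorem sum_twoValue_ge : ∑ i with h ≤ i.val, twoValue (h + h) m c i = h * (m - c) := by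
  rw [Finset.sum_congr rfl fun i hi => twoValue_of_le m c (Finset.mem_filter.mp hi).2,
    Finset.sum_const, nsmul_eq_mul, card_filter_le_val (by omega)]
  push_cast
  ring

theorem sum_twoValue : ∑ i, twoValue (h + h) m c i = 2 * (h * m) := by
  rw [← sum_lt_add_sum_ge _ h, sum_twoValue_lt, sum_twoValue_ge]
  ring

theorem antitone_twoValue (hc : 0 ≤ c) : Antitone (twoValue (h + h) m c) := by
  intro i j hij
  have := Fin.le_def.mp hij
  simp only [twoValue]
  split_ifs <;> omega

theorem mean_twoValue (hh : 0 < h) : mean (twoValue (h + h) m c) = m := by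
  have : (h : ℝ) ≠ 0 := by positivity
  rw [mean, sum_twoValue]
  push_cast
  field_simp
  ring

theorem rg_twoValue (hh : 0 < h) (hc : 0 ≤ c) : rg (twoValue (h + h) m c) = c := by
  have hc' : (0 : ℝ) ≤ c := by exact_mod_cast hc
  have key : ∀ i, |(twoValue (h + h) m c i : ℝ) - mean (twoValue (h + h) m c)| = c := by
    intro i
    rw [mean_twoValue m c hh, twoValue]
    split_ifs <;> push_cast
    · rw [add_sub_cancel_left, abs_of_nonneg hc']
    · rw [sub_sub_cancel_left, abs_neg, abs_of_nonneg hc']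
  exact rg_eq hc' (fun i => (key i).le) ⟨⟨0, by omega⟩, key _⟩

variable {m c}

theorem not_sum_twoValue_le (hh : 0 < h) (hc : (h : ℤ) - 1 < 2 * c) :
    ¬ ∑ i with i.val < h, twoValue (h + h) m c i ≤
      (h : ℤ) * (h - 1) + ∑ i with h ≤ i.val, twoValue (h + h) m c i := by
  rw [sum_twoValue_lt, sum_twoValue_ge, not_le]
  have : (0 : ℤ) < h := by exact_mod_cast hh
  nlinarith

theorem not_erdosGallaiAt_twoValue (hh : 0 < h) (hc : (h : ℤ) - 1 < 2 * c) :
    ¬ ErdosGallaiAt (twoValue (h + h) m c) h := fun hEG =>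
  not_sum_twoValue_le hh hc
    (hEG.trans (add_le_add le_rfl (Finset.sum_le_sum fun _ _ => min_le_left _ _)))

theorem not_graphic_twoValue (hh : 0 < h) (hc : (h : ℤ) - 1 < 2 * c) :
    ¬ Graphic (twoValue (h + h) m c) := by
  intro hg
  obtain ⟨G, hG⟩ := graphic_iff.mp hg
  have := sum_deg_lt_le (k := h) (by omega) G
  simp only [hG] at this
  exact not_sum_twoValue_le hh hc this

end TwoValue

end DegSeq

theorem mainTheorem1 :
    (∀ (n : ℕ) [NeZero n] (π : Fin n → ℤ),
      0 ≤ DegSeq.minVal π → DegSeq.minVal π ≤ DegSeq.maxVal π →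
      DegSeq.maxVal π ≤ (n : ℤ) - 1 → Even (∑ i, π i) →
      ((DegSeq.rg π ≤ ((n : ℝ) - 2) / 4 →
          ((n : ℝ) - 2) / 4 ≤ DegSeq.mean π → DegSeq.mean π ≤ (3 * (n : ℝ) - 2) / 4 →
          DegSeq.Graphic π) ∧
        (DegSeq.rg π ≤ (n : ℝ) - 1 - DegSeq.mean π →
          (3 * (n : ℝ) - 2) / 4 < DegSeq.mean π →
          DegSeq.Graphic π) ∧
        (DegSeq.rg π ≤ DegSeq.mean π →
          DegSeq.mean π < ((n : ℝ) - 2) / 4 →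
          DegSeq.Graphic π))) ∧
    (∀ (n : ℕ), 2 ≤ n → Even n → ∀ (m c : ℤ), ((n : ℝ) - 2) / 4 < (c : ℝ) →
      Antitone (DegSeq.twoValue n m c) ∧
      Even (∑ i, DegSeq.twoValue n m c i) ∧
      DegSeq.mean (DegSeq.twoValue n m c) = (m : ℝ) ∧
      DegSeq.rg (DegSeq.twoValue n m c) = (c : ℝ) ∧
      ¬ DegSeq.ErdosGallaiAt (DegSeq.twoValue n m c) (n / 2) ∧
      ¬ DegSeq.Graphic (DegSeq.twoValue n m c)) ∧
    (∀ (n : ℕ) [NeZero n], 4 ≤ n → Even n → ∃ (m c : ℤ),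
      ((n : ℝ) - 2) / 4 < (c : ℝ) ∧ (c : ℝ) ≤ ((n : ℝ) - 2) / 4 + 1 ∧
      ((n : ℝ) - 2) / 4 ≤ (m : ℝ) ∧ (m : ℝ) ≤ (3 * (n : ℝ) - 2) / 4 ∧
      0 ≤ DegSeq.minVal (DegSeq.twoValue n m c) ∧
      DegSeq.maxVal (DegSeq.twoValue n m c) ≤ (n : ℤ) - 1) := by

  refine ⟨fun n _ π h0 _ hn heven => ?_, fun n hn heven m c hc => ?_, fun n _ hn heven => ?_⟩
  · have h0' : ∀ i, 0 ≤ π i := fun i => h0.trans (Finset.inf'_le _ (Finset.mem_univ i))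
    have hn' : ∀ i, π i ≤ (n : ℤ) - 1 := fun i => (Finset.le_sup' _ (Finset.mem_univ i)).trans hn
    have hc0 : ∀ i, 0 ≤ (n : ℤ) - 1 - π i := fun i => by linarith [hn' i]
    have hcn : ∀ i, (n : ℤ) - 1 - π i ≤ (n : ℤ) - 1 := fun i => by linarith [h0' i]
    have hce := DegSeq.even_sum_compl heven
    have hcm := DegSeq.mean_compl π
    refine ⟨fun hr h1 h2 => ?_, fun hr h1 => ?_, fun hr h1 => ?_⟩
    -- Complementation reflects means about `(n - 1) / 2`, so the upper half of case 1 reduces to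
    -- its lower half, and case 2 to case 3.
    · have hr' := DegSeq.isRegular_of_rg_le hr
      rcases le_total (DegSeq.mean π) (((n : ℝ) - 1) / 2) with h | h
      · exact DegSeq.graphic_of_mean_le h0' hn' heven hr' h1 h
      · exact DegSeq.Graphic.of_compl (DegSeq.graphic_of_mean_le hc0 hcn hce hr'.compl
          (by rw [hcm]; linarith) (by rw [hcm]; linarith))
    · have hr' := (DegSeq.isRegular_of_rg_le hr).compl
      rw [← hcm] at hr'
      exact DegSeq.Graphic.of_compl (DegSeq.graphic_of_mean_lt hc0 hcn hce hr'
        (by rw [hcm]; linarith))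
    · exact DegSeq.graphic_of_mean_lt h0' hn' heven (DegSeq.isRegular_of_rg_le hr) h1
  · obtain ⟨h, rfl⟩ := heven
    have hh : 0 < h := by omega
    have hc1 : (h : ℤ) - 1 < 2 * c := by
      have : (h : ℝ) - 1 < 2 * c := by
        push_cast at hc
        linarith
      exact_mod_cast this
    have hc0 : 0 ≤ c := by omega
    have hhalf : (h + h) / 2 = h := by omega
    rw [hhalf]
    exact ⟨DegSeq.antitone_twoValue m c hc0, by rw [DegSeq.sum_twoValue]; exact even_two_mul _,
      DegSeq.mean_twoValue m c hh, DegSeq.rg_twoValue m c hh hc0,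
      DegSeq.not_erdosGallaiAt_twoValue hh hc1, DegSeq.not_graphic_twoValue hh hc1⟩
  · obtain ⟨h, rfl⟩ := heven
    have hh : (2 : ℝ) ≤ h := by
      have : 2 ≤ h := by omega
      exact_mod_cast this
    obtain ⟨c, hc1, hc2⟩ : ∃ c : ℤ, (h : ℤ) ≤ 2 * c ∧ 2 * c ≤ h + 1 :=
      -- This is `h / 2` rounded up. Taking `m = c` makes the values `2 * c` and `0`, with `2 * c ≤
      -- h + 1 ≤ 2 * h - 1` because `h ≥ 2`.
      ⟨((h : ℤ) + 1) / 2, by omega, by omega⟩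
    have hc1' : (h : ℝ) ≤ 2 * c := by exact_mod_cast hc1
    have hc2' : 2 * (c : ℝ) ≤ h + 1 := by exact_mod_cast hc2
    refine ⟨c, c, ?_, ?_, ?_, ?_, ?_, ?_⟩
    · push_cast
      linarith
    · push_cast
      linarith
    · push_cast
      linarith
    · push_cast
      linarith
    · refine Finset.le_inf' _ _ fun i _ => ?_
      simp only [DegSeq.twoValue]
      split_ifs <;> omega
    · refine Finset.sup'_le _ _ fun i _ => ?_
      simp only [DegSeq.twoValue]
      split_ifs <;> omega
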